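/- Let $D$ be an ordered division ring and let $\mathcal R=\langle R,<,0,+,\{\lambda\}_{\lambda\in D}\rangle$ be an ordered vector space over $D$; give $R$ the order topology, $R^n$ the product topology, and let "definable" mean definable in $\mathcal R$ with parameters. Cells are defined inductively: $R^0$ is a cell of dimension $0$; a cell in $R^{n+1}$ is either the graph $\Gamma(f)$ of a continuous definable function $f:X\to R$ on a cell $X\subseteq R^n$ (with $\dim\Gamma(f)=\dim X$), or a set $(f,g)_X=\{(x,y): x\in X,\ f(x)<y<g(x)\}$ where $X\subseteq R^n$ is a cell, each of $f,g$ is a continuous definable function $X\to R$ or one of the constants $\pm\infty$, and $f<g$ on $X$ (with $\dim (f,g)_X=\dim X+1$). A linear cell is defined in the same way, with the continuous definable functions replaced by the restrictions to $X$ of functions $x\mapsto \lambda_1x_1+\dots+\lambda_nx_n+a$ ($\lambda_i\in D$, $a\in R$). A decomposition of $R^{n+1}$ is a finite partition of $R^{n+1}$ into cells whose projections to the first $n$ coordinates form a decomposition of $R^n$ (the only decomposition of $R^0$ is $\{R^0\}$); it is linear if all its members are linear cells. A decomposition $\mathcal C$ refines $\mathcal D$ if every member of $\mathcal D$ is a union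 of members of $\mathcal C$. For $X\subseteq R^n$, the star of $X$ with respect to $\mathcal C$ is $\mathrm{st}_{\mathcal C}(X)=\bigcup\{A\in\mathcal C: X\cap \mathrm{cl}(A)\neq\emptyset\}$. A stratification of $R^n$ is a finite partition of $R^n$ into cells such that for each cell $A$ of the partition, $\mathrm{cl}(A)\setminus A$ is a union of cells of the partition of lower dimension than $A$. Theorem. For every linear decomposition $\mathcal D$ of $R^n$ there is a linear decomposition $\mathcal C$ of $R^n$ that refines $\mathcal D$ such that for every $C\in\mathcal C$ the star $\mathrm{st}_{\mathcal C}(C)$ is an open subset of $R^n$ and a (usual) cell. Moreover, $\mathcal C$ is a stratification of $R^n$. -/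

import Mathlib

/-! ### The structure `⟨R, <, 0, +, {λ}_{λ ∈ D}⟩` and definable maps -/

namespace OVS

/-- Function symbols: a constant `0`, a binary `+`, and a unary symbol for each scalar of `D`. -/
inductive Func (D : Type*) : ℕ → Type _
  | zero : Func D 0
  | scal (c : D) : Func D 1
  | add : Func D 2

/-- Relation symbols: a single binary symbol `<`. -/
inductive Rel : ℕ → Type
  | lt : Rel 2

/-- The first-order language of ordered vector spaces over `D`. -/
def language (D : Type*) : FirstOrder.Language := ⟨Func D, Rel⟩

/-- An ordered vector space `R` over `D` as a first-order structure. -/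
instance instStructure (D R : Type*) [DivisionRing D] [AddCommGroup R] [LinearOrder R]
    [Module D R] : (language D).Structure R where
  funMap := fun {_} f => match f with
    | Func.zero => fun _ => 0
    | Func.scal c => fun v => c • v 0
    | Func.add => fun v => v 0 + v 1
  RelMap := fun {_} r => match r with
    | Rel.lt => fun v => v 0 < v 1

/-- The projection `R^(n+1) → R^n` onto the first `n` coordinates. -/
def proj {R : Type*} {n : ℕ} (z : Fin (n + 1) → R) : Fin n → R := fun i => z i.castSucc

/-- The graph of `f` restricted to `X`, a subset of `R^(n+1)`. -/
def graph {R : Type*} {n : ℕ} (X : Set (Fin n → R)) (f : (Fin n → R) → R) :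
    Set (Fin (n + 1) → R) :=
  {z | proj z ∈ X ∧ z (Fin.last n) = f (proj z)}

/-- `R ∪ {-∞, +∞}`. -/
abbrev Ext (R : Type*) : Type _ := WithBot (WithTop R)

/-- The inclusion of `R` into `R ∪ {-∞, +∞}`. -/
def Ext.of {R : Type*} (y : R) : Ext R := ((y : WithTop R) : WithBot (WithTop R))

/-- The generalized cylinder `(f, g)_X = {(x, y) : x ∈ X, f x < y < g x}`. -/
def cylinder {R : Type*} [LinearOrder R] {n : ℕ} (X : Set (Fin n → R))
    (f g : (Fin n → R) → Ext R) : Set (Fin (n + 1) → R) :=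
  {z | proj z ∈ X ∧ f (proj z) < Ext.of (z (Fin.last n)) ∧ Ext.of (z (Fin.last n)) < g (proj z)}

/-- `f` restricted to `X` is either a function `X → R` which satisfies `P`, or the constant `-∞`,
or the constant `+∞`. -/
def WithInfty {R : Type*} {n : ℕ} (P : ((Fin n → R) → R) → Prop) (X : Set (Fin n → R))
    (f : (Fin n → R) → Ext R) : Prop :=
  (∃ f₀ : (Fin n → R) → R, P f₀ ∧ ∀ x ∈ X, f x = Ext.of (f₀ x)) ∨
    (∀ x ∈ X, f x = ⊥) ∨ (∀ x ∈ X, f x = ⊤)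

/-- `f` restricted to `X` is a continuous function on `X` that is definable (with parameters)
in the ordered vector space `R` over `D`, that is, its graph is a definable set. -/
def ContDefOn (D : Type*) {R : Type*} [DivisionRing D] [AddCommGroup R] [LinearOrder R]
    [Module D R] [TopologicalSpace R] {n : ℕ} (X : Set (Fin n → R)) (f : (Fin n → R) → R) : Prop :=
  ContinuousOn f X ∧ Set.univ.Definable (language D) (graph X f)

/-- `f` is a linear (that is, affine) function on `X`:
`f x = λ₁ x₁ + ⋯ + λₙ xₙ + a` for `x ∈ X`, with scalars `λᵢ ∈ D` and `a ∈ R`. -/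
def LinearOn (D : Type*) {R : Type*} [DivisionRing D] [AddCommGroup R] [Module D R] {n : ℕ}
    (X : Set (Fin n → R)) (f : (Fin n → R) → R) : Prop :=
  ∃ (c : Fin n → D) (a : R), ∀ x ∈ X, f x = ∑ i, c i • x i + a

/-! ### Cells -/

/-- `s` is a (usual) cell in `R^n` of dimension `d`, i.e. an `(i₁, …, iₙ)`-cell with
`i₁ + ⋯ + iₙ = d`. The one-point space `R^0` is a cell of dimension `0`; a cell in `R^(n+1)` is
either the graph of a continuous definable function on a cell `X` in `R^n` (same dimension as `X`),
or a cylinder `(f, g)_X` with `f < g` on `X`, where each of `f`, `g` is continuous definable or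
constantly `±∞` (one dimension more). For `n + 1 = 1` this gives the points and the open
intervals with endpoints in `R ∪ {-∞, +∞}`. -/
def IsCellOfDim (D : Type*) {R : Type*} [DivisionRing D] [AddCommGroup R] [LinearOrder R]
    [Module D R] [TopologicalSpace R] : (n : ℕ) → ℕ → Set (Fin n → R) → Prop
  | 0, d, s => d = 0 ∧ s = Set.univ
  | n + 1, d, s =>
    (∃ (X : Set (Fin n → R)) (f : (Fin n → R) → R),
      IsCellOfDim D n d X ∧ ContDefOn D X f ∧ s = graph X f) ∨
    (∃ (e : ℕ) (X : Set (Fin n → R)) (f g : (Fin n → R) → Ext R),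
      d = e + 1 ∧ IsCellOfDim D n e X ∧ WithInfty (ContDefOn D X) X f ∧
      WithInfty (ContDefOn D X) X g ∧ (∀ x ∈ X, f x < g x) ∧ s = cylinder X f g)

/-- `s` is a (usual) cell in `R^n`. -/
def IsCell (D : Type*) {R : Type*} [DivisionRing D] [AddCommGroup R] [LinearOrder R]
    [Module D R] [TopologicalSpace R] {n : ℕ} (s : Set (Fin n → R)) : Prop :=
  ∃ d : ℕ, IsCellOfDim D n d s

/-- `s` is a linear cell in `R^n`: as for cells, but with linear functions instead of
continuous definable ones. -/
def IsLinearCell (D : Type*) {R : Type*} [DivisionRing D] [AddCommGroup R] [LinearOrder R]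
    [Module D R] : (n : ℕ) → Set (Fin n → R) → Prop
  | 0, s => s = Set.univ
  | n + 1, s =>
    (∃ (X : Set (Fin n → R)) (f : (Fin n → R) → R),
      IsLinearCell D n X ∧ LinearOn D X f ∧ s = graph X f) ∨
    (∃ (X : Set (Fin n → R)) (f g : (Fin n → R) → Ext R),
      IsLinearCell D n X ∧ WithInfty (LinearOn D X) X f ∧
      WithInfty (LinearOn D X) X g ∧ (∀ x ∈ X, f x < g x) ∧ s = cylinder X f g)

/-! ### Decompositions, stars, stratifications -/

/-- `𝒞` is a decomposition of `R^n`: a finite partition into cells such that the set of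
projections of its members is a decomposition of `R^(n-1)`. The only decomposition of the point
`R^0` is `{R^0}`, so a decomposition of `R` is a finite partition into points and open intervals. -/
def IsDecomposition (D : Type*) {R : Type*} [DivisionRing D] [AddCommGroup R] [LinearOrder R]
    [Module D R] [TopologicalSpace R] : (n : ℕ) → Set (Set (Fin n → R)) → Prop
  | 0, 𝒞 => 𝒞 = {Set.univ}
  | n + 1, 𝒞 =>
    𝒞.Finite ∧ Setoid.IsPartition 𝒞 ∧ (∀ A ∈ 𝒞, IsCell D A) ∧
      IsDecomposition D n ((fun A => proj '' A) '' 𝒞)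

/-- A linear decomposition of `R^n`: a decomposition all of whose members are linear cells. -/
def IsLinearDecomposition (D : Type*) {R : Type*} [DivisionRing D] [AddCommGroup R]
    [LinearOrder R] [Module D R] [TopologicalSpace R] {n : ℕ} (𝒞 : Set (Set (Fin n → R))) : Prop :=
  IsDecomposition D n 𝒞 ∧ ∀ A ∈ 𝒞, IsLinearCell D n A

/-- `𝒞` refines `𝒟`: every member of `𝒟` is a union of members of `𝒞`. -/
def Refines {α : Type*} (𝒞 𝒟 : Set (Set α)) : Prop :=
  ∀ B ∈ 𝒟, ∃ 𝒯 ⊆ 𝒞, B = ⋃₀ 𝒯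

/-- The star of `X` with respect to `𝒞`: the union of all members of `𝒞` whose closure
meets `X`. -/
def star {α : Type*} [TopologicalSpace α] (𝒞 : Set (Set α)) (X : Set α) : Set α :=
  ⋃₀ {A | A ∈ 𝒞 ∧ (X ∩ closure A).Nonempty}

/-- `𝒞` is a stratification of `R^n`: a finite partition of `R^n` into cells such that
the frontier `cl(A) \ A` of each `A ∈ 𝒞` is a union of members of `𝒞` of lower dimension. -/
def IsStratification (D : Type*) {R : Type*} [DivisionRing D] [AddCommGroup R] [LinearOrder R]
    [Module D R] [TopologicalSpace R] {n : ℕ} (𝒞 : Set (Set (Fin n → R))) : Prop :=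
  𝒞.Finite ∧ Setoid.IsPartition 𝒞 ∧ (∀ A ∈ 𝒞, IsCell D A) ∧
    ∀ A ∈ 𝒞, ∃ 𝒯 ⊆ 𝒞, closure A \ A = ⋃₀ 𝒯 ∧
      ∀ B ∈ 𝒯, ∃ d e : ℕ, IsCellOfDim D n d B ∧ IsCellOfDim D n e A ∧ d < e

end OVS

/-!
A finite family `L` of affine functions on `R^n` together with a decomposition `𝒞` of `R^n` on whose
members the functions of `L` keep their relative order cuts `R^(n+1)` into *sign sets*
`signSet L X A B`: the points over `X ∈ 𝒞` that lie above exactly the functions in `A ⊆ L` and below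
exactly those in `B ⊆ L`. A nonempty sign set is the graph of a member of `L` over `X`, or the band
over `X` between two consecutive members of `L`, so the sign sets form a linear decomposition
`stack 𝒞 L`.

If `𝒞` has the required properties, `stack 𝒞 L` inherits them, because closures of sign sets can be
read off their labels. For nonempty sign sets, `signSet L Y A' B'` meets the closure of
`signSet L X A B` if and only if it is contained in it, if and only if `Y ⊆ closure X`, `A' ⊆ A` and `B' ⊆ B`
(`of_signSet_inter_closure_nonempty`, `signSet_subset_closure`). This gives the frontier condition,
and it shows that the star of `signSet L Y A B` is the set of all points over the star of `Y` above
all functions in `A` and below all functions in `B` (`star_stack`). The latter is the open cylinder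
over the star of `Y` between the maximum of `A` and the minimum of `B`, which are continuous and
definable but in general only piecewise linear: the star is a usual cell.

By induction on `n`, every finite family `F` of affine functions on `R^n` admits such a decomposition
on whose members each function of `F` has constant sign (`exists_isGoodDecomposition`): solving
`f = 0` for the last coordinate turns `F` into `L`, and the decomposition of the base is chosen to
fix the order of the functions in `L`. A linear cell is cut out by sign conditions on finitely many
affine functions (`IsLinearCell.exists_finset`), so for a suitable `F` the decomposition refines `𝒟`.
The argument needs `R` to be densely ordered without endpoints, hence nontrivial; for trivial `R`
the space is a point, and `𝒟` itself has the required properties.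
-/

open FirstOrder

namespace OVS

/-! ### Affine functions: algebra, continuity, definability -/

section Affine

variable {D R : Type*} [DivisionRing D] [AddCommGroup R] [Module D R]

theorem LinearOn.neg {n : ℕ} {X : Set (Fin n → R)} {f : (Fin n → R) → R}
    (hf : LinearOn D X f) : LinearOn D X (-f) := by
  obtain ⟨c, a, h⟩ := hf
  refine ⟨-c, -a, fun x hx => ?_⟩
  simp [h x hx, Finset.sum_neg_distrib, add_comm]

theorem LinearOn.add {n : ℕ} {X : Set (Fin n → R)} {f g : (Fin n → R) → R}
    (hf : LinearOn D X f) (hg : LinearOn D X g) : LinearOn D X (f + g) := by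
  obtain ⟨c, a, h⟩ := hf
  obtain ⟨c', a', h'⟩ := hg
  refine ⟨c + c', a + a', fun x hx => ?_⟩
  simp only [Pi.add_apply, h x hx, h' x hx, add_smul, Finset.sum_add_distrib]
  abel

theorem LinearOn.sub {n : ℕ} {X : Set (Fin n → R)} {f g : (Fin n → R) → R}
    (hf : LinearOn D X f) (hg : LinearOn D X g) : LinearOn D X (f - g) :=
  sub_eq_add_neg f g ▸ hf.add hg.neg

theorem LinearOn.smul {n : ℕ} {X : Set (Fin n → R)} {f : (Fin n → R) → R} (d : D)
    (hf : LinearOn D X f) : LinearOn D X (d • f) := by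
  obtain ⟨c, a, h⟩ := hf
  refine ⟨d • c, d • a, fun x hx => ?_⟩
  simp [h x hx, Finset.smul_sum, mul_smul]

theorem LinearOn.mono {n : ℕ} {X Y : Set (Fin n → R)} {f : (Fin n → R) → R}
    (hf : LinearOn D Y f) (h : X ⊆ Y) : LinearOn D X f := by
  obtain ⟨c, a, hc⟩ := hf
  exact ⟨c, a, fun x hx => hc x (h hx)⟩

theorem LinearOn.exists_extension {n : ℕ} {X : Set (Fin n → R)} {f : (Fin n → R) → R}
    (hf : LinearOn D X f) : ∃ g, LinearOn D Set.univ g ∧ ∀ x ∈ X, f x = g x := by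
  obtain ⟨c, a, h⟩ := hf
  exact ⟨fun x => ∑ i, c i • x i + a, ⟨c, a, fun _ _ => rfl⟩, h⟩

theorem LinearOn.comp_proj {n : ℕ} {f : (Fin n → R) → R} (hf : LinearOn D Set.univ f) :
    LinearOn D Set.univ (fun z : Fin (n + 1) → R => f (proj z)) := by
  obtain ⟨c, a, h⟩ := hf
  refine ⟨Fin.snoc c 0, a, fun z _ => ?_⟩
  simp [h (proj z) trivial, Fin.sum_univ_castSucc, proj]

theorem linearOn_last {n : ℕ} :
    LinearOn D Set.univ (fun z : Fin (n + 1) → R => z (Fin.last n)) := by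
  refine ⟨Fin.snoc 0 1, 0, fun z _ => ?_⟩
  simp [Fin.sum_univ_castSucc]

theorem LinearOn.exists_eq_proj_add_smul_last {n : ℕ} {f : (Fin (n + 1) → R) → R}
    (hf : LinearOn D Set.univ f) :
    ∃ (g : (Fin n → R) → R) (c : D), LinearOn D Set.univ g ∧
      ∀ z, f z = g (proj z) + c • z (Fin.last n) := by
  obtain ⟨c, a, h⟩ := hf
  refine ⟨fun x => ∑ i, c i.castSucc • x i + a, c (Fin.last n), ⟨_, a, fun _ _ => rfl⟩,
    fun z => ?_⟩
  rw [h z trivial, Fin.sum_univ_castSucc]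
  simp only [proj]
  abel

end Affine

section Continuity

variable {D R : Type*} [DivisionRing D] [LinearOrder D] [IsStrictOrderedRing D]
  [AddCommGroup R] [LinearOrder R] [IsOrderedAddMonoid R] [Module D R]
  [IsStrictOrderedModule D R]

theorem denselyOrdered (D : Type*) {R : Type*} [DivisionRing D] [LinearOrder D]
    [IsStrictOrderedRing D] [AddCommGroup R] [LinearOrder R] [IsOrderedAddMonoid R] [Module D R]
    [IsStrictOrderedModule D R] : DenselyOrdered R := by
  refine ⟨fun a b hab => ?_⟩
  have h2 : (0 : D) < 2⁻¹ := by simp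
  have hba : 0 < (2⁻¹ : D) • (b - a) := smul_pos h2 (sub_pos.2 hab)
  have hsum : (2⁻¹ : D) • (b - a) + (2⁻¹ : D) • (b - a) = b - a := by
    rw [← add_smul, ← two_mul, mul_inv_cancel₀ two_ne_zero, one_smul]
  refine ⟨a + (2⁻¹ : D) • (b - a), lt_add_of_pos_right a hba, ?_⟩
  rw [← sub_pos]
  have h : b - (a + (2⁻¹ : D) • (b - a)) = (2⁻¹ : D) • (b - a) := by
    rw [← sub_sub, sub_eq_iff_eq_add, hsum]
  rwa [h]

variable [TopologicalSpace R] [OrderTopology R]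

theorem continuous_smul_const (c : D) : Continuous fun y : R => c • y := by
  rcases lt_trichotomy c 0 with hc | rfl | hc
  · have h : Continuous fun y : R => (-c) • y :=
      (OrderIso.smulRight (β := R) (neg_pos.2 hc)).continuous
    exact h.neg.congr fun y => by simp
  · simpa using continuous_const
  · exact (OrderIso.smulRight (β := R) hc).continuous

theorem LinearOn.continuous {n : ℕ} {f : (Fin n → R) → R} (hf : LinearOn D Set.univ f) :
    Continuous f := by
  obtain ⟨c, a, h⟩ := hf
  have : f = fun x => ∑ i, c i • x i + a := funext fun x => h x trivial
  rw [this]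
  exact (continuous_finsetSum _ fun i _ =>
    (continuous_smul_const (c i)).comp (continuous_apply i)).add continuous_const

end Continuity

section Definability

variable {D R : Type*} [DivisionRing D] [AddCommGroup R] [LinearOrder R] [Module D R]

/-- Addition as a function symbol of the language with parameters. -/
def addSymb (D R : Type*) : ((language D)[[(Set.univ : Set R)]]).Functions 2 := Sum.inl Func.add

/-- Multiplication by `c` as a function symbol of the language with parameters. -/
def scalSymb {D : Type*} (R : Type*) (c : D) :
    ((language D)[[(Set.univ : Set R)]]).Functions 1 := Sum.inl (Func.scal c)

/-- The order as a relation symbol of the language with parameters. -/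
def ltSymb (D R : Type*) : ((language D)[[(Set.univ : Set R)]]).Relations 2 := Sum.inl Rel.lt

theorem LinearOn.exists_term {n : ℕ} {f : (Fin n → R) → R} (hf : LinearOn D Set.univ f) :
    ∃ t : ((language D)[[(Set.univ : Set R)]]).Term (Fin n), ∀ v, t.realize v = f v := by
  obtain ⟨c, a, h⟩ := hf
  have key : ∀ s : Finset (Fin n), ∃ t : ((language D)[[(Set.univ : Set R)]]).Term (Fin n),
      ∀ v : Fin n → R, t.realize v = ∑ i ∈ s, c i • v i + a := by
    intro s
    induction s using Finset.induction_on with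
    | empty =>
      exact ⟨((language D).con (⟨a, trivial⟩ : (Set.univ : Set R))).term, fun v => by simp⟩
    | insert i s hi ih =>
      obtain ⟨t, ht⟩ := ih
      refine ⟨Language.Functions.apply₂ (addSymb D R)
        (Language.Functions.apply₁ (scalSymb R (c i)) (Language.Term.var i)) t,
        fun v => ?_⟩
      rw [Finset.sum_insert hi, add_assoc, ← ht v]
      rw [Language.Term.realize_functions_apply₂, Language.Term.realize_functions_apply₁]
      rfl
  obtain ⟨t, ht⟩ := key Finset.univ
  exact ⟨t, fun v => (ht v).trans (h v trivial).symm⟩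

theorem LinearOn.definable_lt {n : ℕ} {f g : (Fin n → R) → R} (hf : LinearOn D Set.univ f)
    (hg : LinearOn D Set.univ g) : Set.univ.Definable (language D) {v | f v < g v} := by
  obtain ⟨t, ht⟩ := hf.exists_term
  obtain ⟨u, hu⟩ := hg.exists_term
  refine ⟨Language.Relations.formula₂ (ltSymb D R) t u, ?_⟩
  ext v
  rw [Set.mem_ofPred_eq, Set.mem_ofPred_eq, Language.Formula.realize_rel₂, ← ht v, ← hu v]
  rfl

end Definability

/-! ### Bands between finite families of affine functions -/

section Ext

variable {R : Type*} [LinearOrder R]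

theorem Ext.of_lt_of {a b : R} : Ext.of a < Ext.of b ↔ a < b := by
  simp [Ext.of]

theorem Ext.of_le_of {a b : R} : Ext.of a ≤ Ext.of b ↔ a ≤ b := by
  simp [Ext.of]

theorem Ext.bot_lt_of (a : R) : ⊥ < Ext.of a := WithBot.bot_lt_coe _

theorem Ext.of_lt_top (a : R) : Ext.of a < ⊤ :=
  WithBot.coe_lt_coe.2 (WithTop.coe_lt_top a)

theorem sup_of_eq {ι : Type*} {A : Finset ι} {g : ι → R} {m : R}
    (hm : ∀ a ∈ A, g a ≤ m)
    (h : ∃ a ∈ A, g a = m) : A.sup (fun a => Ext.of (g a)) = Ext.of m := by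
  obtain ⟨a, ha, rfl⟩ := h
  exact le_antisymm (Finset.sup_le fun b hb => Ext.of_le_of.2 (hm b hb))
    (Finset.le_sup (f := fun a => Ext.of (g a)) ha)

theorem inf_of_eq {ι : Type*} {A : Finset ι} {g : ι → R} {m : R}
    (hm : ∀ a ∈ A, m ≤ g a)
    (h : ∃ a ∈ A, g a = m) : A.inf (fun a => Ext.of (g a)) = Ext.of m := by
  obtain ⟨a, ha, rfl⟩ := h
  exact le_antisymm (Finset.inf_le (f := fun a => Ext.of (g a)) ha)
    (Finset.le_inf fun b hb => Ext.of_le_of.2 (hm b hb))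

theorem sup_of_lt_of_iff {ι : Type*} {A : Finset ι} {g : ι → R} {y : R} :
    A.sup (fun a => Ext.of (g a)) < Ext.of y ↔ ∀ a ∈ A, g a < y := by
  have h : (⊥ : Ext R) < Ext.of y := Ext.bot_lt_of y
  simp only [Finset.sup_lt_iff h, Ext.of_lt_of]

theorem of_lt_inf_of_iff {ι : Type*} {A : Finset ι} {g : ι → R} {y : R} :
    Ext.of y < A.inf (fun a => Ext.of (g a)) ↔ ∀ a ∈ A, y < g a := by
  have h : Ext.of y < (⊤ : Ext R) := Ext.of_lt_top y
  simp only [Finset.lt_inf_iff h, Ext.of_lt_of]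

variable {n : ℕ}

/-- The open band over `X` above all functions of `A` and below all functions of `B`; an empty
family imposes no condition, so it plays the role of an infinite bound. -/
def band (X : Set (Fin n → R)) (A B : Finset ((Fin n → R) → R)) : Set (Fin (n + 1) → R) :=
  {z | proj z ∈ X ∧ (∀ a ∈ A, a (proj z) < z (Fin.last n)) ∧
    ∀ b ∈ B, z (Fin.last n) < b (proj z)}

theorem band_eq_cylinder (X : Set (Fin n → R)) (A B : Finset ((Fin n → R) → R)) :
    band X A B = cylinder X (fun x => A.sup fun a => Ext.of (a x))
      (fun x => B.inf fun b => Ext.of (b x)) := by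
  ext z
  simp only [band, cylinder, Set.mem_ofPred_eq, sup_of_lt_of_iff, of_lt_inf_of_iff]

theorem sup_of_lt_inf_of {X : Set (Fin n → R)} {A B : Finset ((Fin n → R) → R)}
    (h : ∀ a ∈ A, ∀ b ∈ B, ∀ x ∈ X, a x < b x) (x : Fin n → R) (hx : x ∈ X) :
    (A.sup fun a => Ext.of (a x)) < B.inf fun b => Ext.of (b x) := by
  rcases A.eq_empty_or_nonempty with rfl | hA
  · rw [Finset.sup_empty, Finset.lt_inf_iff bot_lt_top]
    exact fun b _ => Ext.bot_lt_of _
  · obtain ⟨m, hm, hmax⟩ := A.exists_max_image (fun a => a x) hA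
    rw [sup_of_eq hmax ⟨m, hm, rfl⟩, of_lt_inf_of_iff]
    exact fun b hb => h m hm b hb x hx

end Ext

theorem continuous_proj {R : Type*} [TopologicalSpace R] {n : ℕ} :
    Continuous (proj : (Fin (n + 1) → R) → Fin n → R) :=
  continuous_pi fun i => continuous_apply i.castSucc

section Bands

variable {D R : Type*} [DivisionRing D] [LinearOrder D] [IsStrictOrderedRing D]
  [AddCommGroup R] [LinearOrder R] [IsOrderedAddMonoid R] [Module D R]
  [IsStrictOrderedModule D R] [TopologicalSpace R] [OrderTopology R] {n : ℕ}

theorem isOpen_band {X : Set (Fin n → R)} {A B : Finset ((Fin n → R) → R)} (hX : IsOpen X)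
    (hA : ∀ a ∈ A, LinearOn D Set.univ a) (hB : ∀ b ∈ B, LinearOn D Set.univ b) :
    IsOpen (band X A B) := by
  have : band X A B = proj ⁻¹' X ∩ ((⋂ a ∈ A, {z | a (proj z) < z (Fin.last n)}) ∩
      ⋂ b ∈ B, {z | z (Fin.last n) < b (proj z)}) := by
    ext z
    simp [band]
  rw [this]
  refine (hX.preimage continuous_proj).inter ((isOpen_biInter_finset fun a ha => ?_).inter
    (isOpen_biInter_finset fun b hb => ?_))
  · exact isOpen_lt ((hA a ha).continuous.comp continuous_proj) (continuous_apply _)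
  · exact isOpen_lt (continuous_apply _) ((hB b hb).continuous.comp continuous_proj)

theorem continuous_finset_sup' {A : Finset ((Fin n → R) → R)} (hA : A.Nonempty)
    (h : ∀ a ∈ A, LinearOn D Set.univ a) : Continuous fun x => A.sup' hA fun a => a x :=
  Continuous.finset_sup'_apply hA fun a ha => (h a ha).continuous

theorem continuous_finset_inf' {A : Finset ((Fin n → R) → R)} (hA : A.Nonempty)
    (h : ∀ a ∈ A, LinearOn D Set.univ a) : Continuous fun x => A.inf' hA fun a => a x :=
  Continuous.finset_inf'_apply hA fun a ha => (h a ha).continuous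

end Bands

section Definable

variable {D R : Type*} [DivisionRing D] [AddCommGroup R] [LinearOrder R] [Module D R] {n : ℕ}

theorem definable_proj_preimage {X : Set (Fin n → R)}
    (hX : Set.univ.Definable (language D) X) :
    Set.univ.Definable (language D) (proj ⁻¹' X : Set (Fin (n + 1) → R)) :=
  hX.preimage_comp Fin.castSucc

theorem definable_forall_finset {ι α : Type*} (A : Finset ι) {P : ι → (α → R) → Prop}
    (h : ∀ i ∈ A, Set.univ.Definable (language D) {v | P i v}) :
    Set.univ.Definable (language D) {v | ∀ i ∈ A, P i v} := by
  have := Set.definable_iInter_of_finite fun i : A => h i i.2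
  convert this using 1
  ext v
  simp

theorem definable_exists_finset {ι α : Type*} (A : Finset ι) {P : ι → (α → R) → Prop}
    (h : ∀ i ∈ A, Set.univ.Definable (language D) {v | P i v}) :
    Set.univ.Definable (language D) {v | ∃ i ∈ A, P i v} := by
  have := Set.definable_iUnion_of_finite fun i : A => h i i.2
  convert this using 1
  ext v
  simp

theorem LinearOn.definable_le {f g : (Fin n → R) → R} (hf : LinearOn D Set.univ f)
    (hg : LinearOn D Set.univ g) : Set.univ.Definable (language D) {v | f v ≤ g v} := by
  convert (hg.definable_lt hf).compl using 1
  ext v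
  simp

theorem LinearOn.definable_eq {f g : (Fin n → R) → R} (hf : LinearOn D Set.univ f)
    (hg : LinearOn D Set.univ g) : Set.univ.Definable (language D) {v | f v = g v} := by
  convert (hf.definable_le hg).inter (hg.definable_le hf) using 1
  ext v
  exact le_antisymm_iff

theorem definable_graph_finset_sup' {X : Set (Fin n → R)}
    (hX : Set.univ.Definable (language D) X) {A : Finset ((Fin n → R) → R)} (hA : A.Nonempty)
    (h : ∀ a ∈ A, LinearOn D Set.univ a) :
    Set.univ.Definable (language D) (graph X fun x => A.sup' hA fun a => a x) := by
  convert (definable_proj_preimage hX).inter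
    ((definable_forall_finset A fun a ha => (h a ha).comp_proj.definable_le linearOn_last).inter
    (definable_exists_finset A fun a ha => linearOn_last.definable_le (h a ha).comp_proj)) using 1
  ext z
  simp only [graph, Set.mem_ofPred_eq, Set.mem_inter_iff, Set.mem_preimage, le_antisymm_iff,
    Finset.sup'_le_iff, Finset.le_sup'_iff]
  tauto

theorem definable_graph_finset_inf' {X : Set (Fin n → R)}
    (hX : Set.univ.Definable (language D) X) {A : Finset ((Fin n → R) → R)} (hA : A.Nonempty)
    (h : ∀ a ∈ A, LinearOn D Set.univ a) :
    Set.univ.Definable (language D) (graph X fun x => A.inf' hA fun a => a x) := by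
  convert (definable_proj_preimage hX).inter
    ((definable_forall_finset A fun a ha => linearOn_last.definable_le (h a ha).comp_proj).inter
    (definable_exists_finset A fun a ha => (h a ha).comp_proj.definable_le linearOn_last)) using 1
  ext z
  simp only [graph, Set.mem_ofPred_eq, Set.mem_inter_iff, Set.mem_preimage, le_antisymm_iff,
    Finset.inf'_le_iff, Finset.le_inf'_iff]

theorem definable_graph_linearOn {X : Set (Fin n → R)}
    (hX : Set.univ.Definable (language D) X) {l : (Fin n → R) → R}
    (h : LinearOn D Set.univ l) : Set.univ.Definable (language D) (graph X l) :=
  (definable_proj_preimage hX).inter (linearOn_last.definable_eq h.comp_proj)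

theorem definable_band {X : Set (Fin n → R)} {A B : Finset ((Fin n → R) → R)}
    (hX : Set.univ.Definable (language D) X) (hA : ∀ a ∈ A, LinearOn D Set.univ a)
    (hB : ∀ b ∈ B, LinearOn D Set.univ b) :
    Set.univ.Definable (language D) (band X A B) :=
  (definable_proj_preimage hX).inter
    ((definable_forall_finset A fun a ha => (hA a ha).comp_proj.definable_lt linearOn_last).inter
    (definable_forall_finset B fun b hb => linearOn_last.definable_lt (hB b hb).comp_proj))

/-- The functions of `L` have the same relative order at all points of `X`. -/
def SameOrderOn (L : Finset ((Fin n → R) → R)) (X : Set (Fin n → R)) : Prop :=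
  ∀ l ∈ L, ∀ l' ∈ L, ∀ x ∈ X, ∀ y ∈ X, l x < l' x → l y < l' y

/-- If the relative order of the bounding functions does not change on `X`, their maximum and
their minimum are each attained by a single function on all of `X`. -/
theorem isLinearCell_band {X : Set (Fin n → R)} (hX : IsLinearCell D n X)
    {L A B : Finset ((Fin n → R) → R)} (hL : ∀ l ∈ L, LinearOn D Set.univ l)
    (hord : SameOrderOn L X) (hne : X.Nonempty) (hA : A ⊆ L) (hB : B ⊆ L)
    (h : ∀ a ∈ A, ∀ b ∈ B, ∀ x ∈ X, a x < b x) :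
    IsLinearCell D (n + 1) (band X A B) := by
  obtain ⟨x₀, hx₀⟩ := hne
  refine Or.inr ⟨X, _, _, hX, ?_, ?_, sup_of_lt_inf_of h, band_eq_cylinder X A B⟩
  · rcases A.eq_empty_or_nonempty with rfl | hne
    · exact Or.inr (Or.inl fun _ _ => rfl)
    · obtain ⟨m, hm, hmax⟩ := A.exists_max_image (fun a => a x₀) hne
      exact Or.inl ⟨m, (hL m (hA hm)).mono (Set.subset_univ X), fun x hx =>
        sup_of_eq (fun a ha => not_lt.1 fun hlt =>
          (hmax a ha).not_gt (hord m (hA hm) a (hA ha) x hx x₀ hx₀ hlt)) ⟨m, hm, rfl⟩⟩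
  · rcases B.eq_empty_or_nonempty with rfl | hne
    · exact Or.inr (Or.inr fun _ _ => rfl)
    · obtain ⟨m, hm, hmin⟩ := B.exists_min_image (fun b => b x₀) hne
      exact Or.inl ⟨m, (hL m (hB hm)).mono (Set.subset_univ X), fun x hx =>
        inf_of_eq (fun b hb => not_lt.1 fun hlt =>
          (hmin b hb).not_gt (hord b (hB hb) m (hB hm) x hx x₀ hx₀ hlt)) ⟨m, hm, rfl⟩⟩

end Definable

section BandCells

variable {D R : Type*} [DivisionRing D] [LinearOrder D] [IsStrictOrderedRing D]
  [AddCommGroup R] [LinearOrder R] [IsOrderedAddMonoid R] [Module D R]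
  [IsStrictOrderedModule D R] [TopologicalSpace R] [OrderTopology R] {n : ℕ}

theorem isCellOfDim_graph {X : Set (Fin n → R)} {d : ℕ} (hX : IsCellOfDim D n d X)
    (hdef : Set.univ.Definable (language D) X) {l : (Fin n → R) → R}
    (h : LinearOn D Set.univ l) : IsCellOfDim D (n + 1) d (graph X l) :=
  Or.inl ⟨X, l, hX, ⟨h.continuous.continuousOn, definable_graph_linearOn hdef h⟩, rfl⟩

theorem isCellOfDim_band {X : Set (Fin n → R)} {d : ℕ} (hX : IsCellOfDim D n d X)
    (hdef : Set.univ.Definable (language D) X) {A B : Finset ((Fin n → R) → R)}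
    (hA : ∀ a ∈ A, LinearOn D Set.univ a) (hB : ∀ b ∈ B, LinearOn D Set.univ b)
    (h : ∀ a ∈ A, ∀ b ∈ B, ∀ x ∈ X, a x < b x) :
    IsCellOfDim D (n + 1) (d + 1) (band X A B) := by
  refine Or.inr ⟨d, X, _, _, rfl, hX, ?_, ?_, sup_of_lt_inf_of h, band_eq_cylinder X A B⟩
  · rcases A.eq_empty_or_nonempty with rfl | hne
    · exact Or.inr (Or.inl fun _ _ => rfl)
    · exact Or.inl ⟨_, ⟨(continuous_finset_sup' hne hA).continuousOn,
        definable_graph_finset_sup' hdef hne hA⟩, fun x _ =>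
        sup_of_eq (fun a ha => Finset.le_sup' (fun a => a x) ha)
          ((Finset.exists_mem_eq_sup' hne fun a => a x).imp fun a ha => ⟨ha.1, ha.2.symm⟩)⟩
  · rcases B.eq_empty_or_nonempty with rfl | hne
    · exact Or.inr (Or.inr fun _ _ => rfl)
    · exact Or.inl ⟨_, ⟨(continuous_finset_inf' hne hB).continuousOn,
        definable_graph_finset_inf' hdef hne hB⟩, fun x _ =>
        inf_of_eq (fun b hb => Finset.inf'_le (fun b => b x) hb)
          ((Finset.exists_mem_eq_inf' hne fun b => b x).imp fun b hb => ⟨hb.1, hb.2.symm⟩)⟩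

end BandCells

/-! ### Sign sets over a cell -/

section Snoc

variable {R : Type*} {n : ℕ}

theorem proj_snoc (x : Fin n → R) (y : R) :
    proj (Fin.snoc x y : Fin (n + 1) → R) = x := by
  ext i
  simp [proj]

theorem snoc_proj_last (z : Fin (n + 1) → R) :
    (Fin.snoc (proj z) (z (Fin.last n)) : Fin (n + 1) → R) = z :=
  Fin.snoc_init_self z

end Snoc

section SignSets

variable {R : Type*} [LinearOrder R] {n : ℕ}

/-- The points over `X` lying above exactly the functions of `L` that are in `A`, and below exactly
those that are in `B`. -/
def signSet (L : Finset ((Fin n → R) → R)) (X : Set (Fin n → R))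
    (A B : Finset ((Fin n → R) → R)) : Set (Fin (n + 1) → R) :=
  {z | proj z ∈ X ∧ ∀ l ∈ L, (l (proj z) < z (Fin.last n) ↔ l ∈ A) ∧
    (z (Fin.last n) < l (proj z) ↔ l ∈ B)}

variable {L A B : Finset ((Fin n → R) → R)} {X : Set (Fin n → R)}

theorem exists_mem_signSet {z : Fin (n + 1) → R} (hz : proj z ∈ X) :
    ∃ A ⊆ L, ∃ B ⊆ L, z ∈ signSet L X A B := by
  classical
  refine ⟨L.filter fun l => l (proj z) < z (Fin.last n), Finset.filter_subset _ _,
    L.filter fun l => z (Fin.last n) < l (proj z), Finset.filter_subset _ _, hz, fun l hl => ?_⟩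
  simp [hl]

theorem signSet_unique {A' B' : Finset ((Fin n → R) → R)} {X' : Set (Fin n → R)}
    (hA : A ⊆ L) (hB : B ⊆ L) (hA' : A' ⊆ L) (hB' : B' ⊆ L) {z : Fin (n + 1) → R}
    (hz : z ∈ signSet L X A B) (hz' : z ∈ signSet L X' A' B') : A = A' ∧ B = B' :=
  ⟨Finset.ext fun l => ⟨fun h => (hz'.2 l (hA h)).1.1 ((hz.2 l (hA h)).1.2 h),
      fun h => (hz.2 l (hA' h)).1.1 ((hz'.2 l (hA' h)).1.2 h)⟩,
    Finset.ext fun l => ⟨fun h => (hz'.2 l (hB h)).2.1 ((hz.2 l (hB h)).2.2 h),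
      fun h => (hz.2 l (hB' h)).2.1 ((hz'.2 l (hB' h)).2.2 h)⟩⟩

/-- If no function of `L` passes through the points of a sign set, it is a band. -/
theorem signSet_eq_band (hA : A ⊆ L) (hB : B ⊆ L) (h : ∀ l ∈ L, l ∈ A ∨ l ∈ B) :
    signSet L X A B = band X A B := by
  ext z
  refine ⟨fun hz => ⟨hz.1, fun a ha => (hz.2 a (hA ha)).1.2 ha,
    fun b hb => (hz.2 b (hB hb)).2.2 hb⟩, fun hz => ⟨hz.1, fun l hl =>
      ⟨⟨fun hlt => ?_, hz.2.1 l⟩, ⟨fun hlt => ?_, hz.2.2 l⟩⟩⟩⟩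
  · exact (h l hl).resolve_right fun hb => lt_asymm hlt (hz.2.2 l hb)
  · exact (h l hl).resolve_left fun ha => lt_asymm hlt (hz.2.1 l ha)

theorem last_eq_of_mem_signSet {z : Fin (n + 1) → R} (hz : z ∈ signSet L X A B)
    {l : (Fin n → R) → R} (hl : l ∈ L) (hlA : l ∉ A) (hlB : l ∉ B) :
    z (Fin.last n) = l (proj z) :=
  le_antisymm (not_lt.1 fun h => hlA ((hz.2 l hl).1.1 h))
    (not_lt.1 fun h => hlB ((hz.2 l hl).2.1 h))

/-- If a function of `L` passes through the points of a sign set, the sign set is its graph. -/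
theorem signSet_eq_graph (hord : SameOrderOn L X) (hne : (signSet L X A B).Nonempty)
    {l : (Fin n → R) → R} (hl : l ∈ L) (hlA : l ∉ A) (hlB : l ∉ B) :
    signSet L X A B = graph X l := by
  obtain ⟨z₀, hz₀⟩ := hne
  have h₀ := last_eq_of_mem_signSet hz₀ hl hlA hlB
  ext z
  refine ⟨fun hz => ⟨hz.1, last_eq_of_mem_signSet hz hl hlA hlB⟩, fun hz => ⟨hz.1, fun k hk => ?_⟩⟩
  have hk₀ := hz₀.2 k hk
  rw [h₀] at hk₀
  rw [hz.2, ← hk₀.1, ← hk₀.2]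
  exact ⟨⟨hord k hk l hl _ hz.1 _ hz₀.1, hord k hk l hl _ hz₀.1 _ hz.1⟩,
    ⟨hord l hl k hk _ hz.1 _ hz₀.1, hord l hl k hk _ hz₀.1 _ hz.1⟩⟩

theorem lt_of_signSet_nonempty (hord : SameOrderOn L X) (hne : (signSet L X A B).Nonempty)
    (hA : A ⊆ L) (hB : B ⊆ L) : ∀ a ∈ A, ∀ b ∈ B, ∀ x ∈ X, a x < b x := by
  obtain ⟨z, hz⟩ := hne
  exact fun a ha b hb x hx => hord a (hA ha) b (hB hb) _ hz.1 x hx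
    (((hz.2 a (hA ha)).1.2 ha).trans ((hz.2 b (hB hb)).2.2 hb))

theorem exists_between_functions [DenselyOrdered R] [NoMinOrder R] [NoMaxOrder R] [Nonempty R]
    {x : Fin n → R} {u v : R} (huv : u < v) (h : ∀ a ∈ A, ∀ b ∈ B, a x < b x)
    (hu : ∀ b ∈ B, u < b x) (hv : ∀ a ∈ A, a x < v) :
    ∃ y, u < y ∧ y < v ∧ (∀ a ∈ A, a x < y) ∧ ∀ b ∈ B, y < b x := by
  classical
  obtain ⟨y, hy, hy'⟩ := Order.exists_between_finsets (insert u (A.image fun a => a x))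
    (insert v (B.image fun b => b x)) (by
      simp only [Finset.mem_insert, Finset.mem_image]
      rintro _ (rfl | ⟨a, ha, rfl⟩) _ (rfl | ⟨b, hb, rfl⟩)
      exacts [huv, hu b hb, hv a ha, h a ha b hb])
  simp only [Finset.mem_insert, Finset.mem_image, forall_eq_or_imp, forall_exists_index, and_imp,
    forall_apply_eq_imp_iff₂] at hy hy'
  exact ⟨y, hy.1, hy'.1, hy.2, hy'.2⟩

/-- Over each point of `X` there is a point of a given nonempty sign set; its height can be
chosen in any interval that the functions of the sign set do not prevent it from entering. -/
theorem exists_snoc_mem_signSet [DenselyOrdered R] [NoMinOrder R] [NoMaxOrder R]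
    (hord : SameOrderOn L X) (hne : (signSet L X A B).Nonempty) (hA : A ⊆ L) (hB : B ⊆ L)
    {x : Fin n → R} (hx : x ∈ X) {u v : R} (huv : u < v)
    (hu : ∀ b ∈ L, b ∉ A → u < b x) (hv : ∀ a ∈ L, a ∉ B → a x < v) :
    ∃ y, u < y ∧ y < v ∧ (Fin.snoc x y : Fin (n + 1) → R) ∈ signSet L X A B := by
  have hlt := lt_of_signSet_nonempty hord hne hA hB
  have hdisj : ∀ l ∈ A, l ∉ B := fun l ha hb => lt_irrefl _ (hlt l ha l hb x hx)
  by_cases h : ∀ l ∈ L, l ∈ A ∨ l ∈ B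
  · have : Nonempty R := ⟨u⟩
    obtain ⟨y, h1, h2, h3, h4⟩ := exists_between_functions (A := A) (B := B) huv
      (fun a ha b hb => hlt a ha b hb x hx)
      (fun b hb => hu b (hB hb) fun ha => hdisj b ha hb) fun a ha => hv a (hA ha) (hdisj a ha)
    refine ⟨y, h1, h2, ?_⟩
    rw [signSet_eq_band hA hB h]
    simpa [band, proj_snoc, hx] using And.intro h3 h4
  · push Not at h
    obtain ⟨l, hl, hlA, hlB⟩ := h
    refine ⟨l x, hu l hl hlA, hv l hl hlB, ?_⟩
    rw [signSet_eq_graph hord hne hl hlA hlB]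
    simp [graph, proj_snoc, hx]

theorem proj_image_signSet [DenselyOrdered R] [NoMinOrder R] [NoMaxOrder R]
    (hord : SameOrderOn L X) (hne : (signSet L X A B).Nonempty) (hA : A ⊆ L) (hB : B ⊆ L) :
    proj '' signSet L X A B = X := by
  refine Set.Subset.antisymm (Set.image_subset_iff.2 fun z hz => hz.1) fun x hx => ?_
  classical
  obtain ⟨w, hw⟩ := hne
  have : Nonempty R := ⟨w (Fin.last n)⟩
  obtain ⟨u, -, hu⟩ := Order.exists_between_finsets ∅ (L.image fun l => l x) (by simp)
  obtain ⟨v, hv, -⟩ := Order.exists_between_finsets (insert u (L.image fun l => l x)) ∅ (by simp)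
  simp only [Finset.mem_insert, Finset.mem_image, forall_eq_or_imp, forall_exists_index, and_imp,
    forall_apply_eq_imp_iff₂] at hu hv
  obtain ⟨y, -, -, hy⟩ := exists_snoc_mem_signSet hord ⟨w, hw⟩ hA hB hx hv.1
    (fun b hb _ => hu b hb) fun a ha _ => hv.2 a ha
  exact ⟨_, hy, proj_snoc x y⟩

end SignSets

/-! ### Closures of sign sets -/

section Closure

variable {D R : Type*} [DivisionRing D] [LinearOrder D] [IsStrictOrderedRing D]
  [AddCommGroup R] [LinearOrder R] [IsOrderedAddMonoid R] [Module D R]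
  [IsStrictOrderedModule D R] [TopologicalSpace R] [OrderTopology R] {n : ℕ}
  {L A B A' B' : Finset ((Fin n → R) → R)} {X Y : Set (Fin n → R)}

theorem signSet_subset_closure [Nontrivial R] [DenselyOrdered R]
    (hL : ∀ l ∈ L, LinearOn D Set.univ l) (hord : SameOrderOn L X)
    (hne : (signSet L X A B).Nonempty) (hA : A ⊆ L) (hB : B ⊆ L) (hY : Y ⊆ closure X)
    (hAA : A' ⊆ A) (hBB : B' ⊆ B) : signSet L Y A' B' ⊆ closure (signSet L X A B) := by
  classical
  intro z hz
  refine mem_closure_iff.2 fun o ho hzo => ?_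
  obtain ⟨V, W, hV, hW, hxV, hyW, hVW⟩ := isOpen_prod_iff.1 (ho.preimage
    (continuous_fst.finSnoc continuous_snd)) (proj z) (z (Fin.last n))
    (by simpa only [Set.mem_preimage, snoc_proj_last] using hzo)
  obtain ⟨u, v, ⟨huz, hzv⟩, huv⟩ := mem_nhds_iff_exists_Ioo_subset.1 (hW.mem_nhds hyW)
  have hV' : IsOpen ((⋂ b ∈ L \ A, {x | u < b x}) ∩ ⋂ a ∈ L \ B, {x | a x < v}) :=
    (isOpen_biInter_finset fun b hb => isOpen_lt continuous_const
      (hL b (Finset.mem_sdiff.1 hb).1).continuous).inter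
    (isOpen_biInter_finset fun a ha => isOpen_lt
      (hL a (Finset.mem_sdiff.1 ha).1).continuous continuous_const)
  obtain ⟨x, ⟨hxV, hx⟩, hxX⟩ := mem_closure_iff.1 (hY hz.1) _ (hV.inter hV') ⟨hxV, by
    simp only [Set.mem_inter_iff, Set.mem_iInter, Finset.mem_sdiff, and_imp]
    exact ⟨fun b hb hbA => huz.trans_le (not_lt.1 fun h => hbA (hAA ((hz.2 b hb).1.1 h))),
      fun a ha haB => (not_lt.1 fun h => haB (hBB ((hz.2 a ha).2.1 h))).trans_lt hzv⟩⟩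
  simp only [Set.mem_inter_iff, Set.mem_iInter, Finset.mem_sdiff, and_imp] at hx
  obtain ⟨y, huy, hyv, hy⟩ := exists_snoc_mem_signSet hord hne hA hB hxX (huz.trans hzv) hx.1 hx.2
  exact ⟨_, hVW (Set.mk_mem_prod hxV (huv ⟨huy, hyv⟩)), hy⟩

theorem of_signSet_inter_closure_nonempty (hL : ∀ l ∈ L, LinearOn D Set.univ l)
    (hA' : A' ⊆ L) (hB' : B' ⊆ L)
    (h : (signSet L Y A' B' ∩ closure (signSet L X A B)).Nonempty) :
    (Y ∩ closure X).Nonempty ∧ A' ⊆ A ∧ B' ⊆ B := by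
  obtain ⟨z, hzT, hzS⟩ := h
  refine ⟨⟨proj z, hzT.1, ?_⟩, fun l hl => ?_, fun l hl => ?_⟩
  · exact closure_minimal (t := proj ⁻¹' closure X) (fun w hw => subset_closure hw.1)
      (isClosed_closure.preimage continuous_proj) hzS
  · obtain ⟨w, hw, hwS⟩ := mem_closure_iff.1 hzS {w | l (proj w) < w (Fin.last n)}
      (isOpen_lt ((hL l (hA' hl)).continuous.comp continuous_proj) (continuous_apply _))
      ((hzT.2 l (hA' hl)).1.2 hl)
    exact (hwS.2 l (hA' hl)).1.1 hw
  · obtain ⟨w, hw, hwS⟩ := mem_closure_iff.1 hzS {w | w (Fin.last n) < l (proj w)}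
      (isOpen_lt (continuous_apply _) ((hL l (hB' hl)).continuous.comp continuous_proj))
      ((hzT.2 l (hB' hl)).2.2 hl)
    exact (hwS.2 l (hB' hl)).2.1 hw

/-- A strict inequality that holds on a cell persists on every cell of its star: it is an open
condition, and the relative order of the functions is constant on each cell. -/
theorem SameOrderOn.lt_of_inter_closure_nonempty (hL : ∀ l ∈ L, LinearOn D Set.univ l)
    (hX : SameOrderOn L X) (h : (Y ∩ closure X).Nonempty) {a b : (Fin n → R) → R}
    (ha : a ∈ L) (hb : b ∈ L) (hlt : ∀ x ∈ Y, a x < b x) : ∀ x ∈ X, a x < b x := by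
  obtain ⟨y, hyY, hyX⟩ := h
  obtain ⟨w, hw, hwX⟩ := mem_closure_iff.1 hyX {w | a w < b w}
    (isOpen_lt (hL a ha).continuous (hL b hb).continuous) (hlt y hyY)
  exact fun x hx => hX a ha b hb w hwX x hx hw

end Closure

/-! ### Lifting a decomposition along the projection -/

theorem eq_of_mem_of_isPartition {α : Type*} {𝒞 : Set (Set α)} (h : Setoid.IsPartition 𝒞)
    {X Y : Set α} (hX : X ∈ 𝒞) (hY : Y ∈ 𝒞) {x : α} (hxX : x ∈ X) (hxY : x ∈ Y) : X = Y :=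
  (h.2 x).unique ⟨hX, hxX⟩ ⟨hY, hxY⟩

section Stack

variable {R : Type*} [LinearOrder R] {n : ℕ}

/-- The nonempty sign sets of the family `L` over the members of `𝒞`. -/
def stack (𝒞 : Set (Set (Fin n → R))) (L : Finset ((Fin n → R) → R)) :
    Set (Set (Fin (n + 1) → R)) :=
  {S | S.Nonempty ∧ ∃ X ∈ 𝒞, ∃ A ⊆ L, ∃ B ⊆ L, S = signSet L X A B}

variable {𝒞 : Set (Set (Fin n → R))} {L : Finset ((Fin n → R) → R)}

theorem stack_finite (h : 𝒞.Finite) : (stack 𝒞 L).Finite := by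
  refine ((h.prod ((L.powerset ×ˢ L.powerset).finite_toSet)).image
    fun p => signSet L p.1 p.2.1 p.2.2).subset ?_
  rintro _ ⟨-, X, hX, A, hA, B, hB, rfl⟩
  exact ⟨(X, A, B), ⟨hX, by simp [hA, hB]⟩, rfl⟩

theorem stack_isPartition (h : Setoid.IsPartition 𝒞) : Setoid.IsPartition (stack 𝒞 L) := by
  refine ⟨fun h => Set.not_nonempty_empty h.1, fun z => ?_⟩
  obtain ⟨X, ⟨hX, hzX⟩, -⟩ := h.2 (proj z)
  obtain ⟨A, hA, B, hB, hz⟩ := exists_mem_signSet (L := L) hzX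
  refine ⟨_, ⟨⟨⟨z, hz⟩, X, hX, A, hA, B, hB, rfl⟩, hz⟩, ?_⟩
  rintro _ ⟨⟨-, X', hX', A', hA', B', hB', rfl⟩, hz'⟩
  obtain ⟨rfl, rfl⟩ := signSet_unique hA' hB' hA hB hz' hz
  rw [eq_of_mem_of_isPartition h hX' hX hz'.1 hz.1]

variable [DenselyOrdered R] [NoMinOrder R] [NoMaxOrder R]

theorem proj_image_stack [Nonempty R] (h : Setoid.IsPartition 𝒞)
    (hord : ∀ X ∈ 𝒞, SameOrderOn L X) : (fun S => proj '' S) '' stack 𝒞 L = 𝒞 := by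
  ext X
  constructor
  · rintro ⟨_, ⟨hne, X, hX, A, hA, B, hB, rfl⟩, rfl⟩
    simpa only [proj_image_signSet (hord X hX) hne hA hB] using hX
  · intro hX
    obtain ⟨x, hx⟩ := Setoid.nonempty_of_mem_partition h hX
    obtain ⟨y⟩ := ‹Nonempty R›
    obtain ⟨A, hA, B, hB, hz⟩ := exists_mem_signSet (L := L) (X := X)
      (z := (Fin.snoc x y : Fin (n + 1) → R)) (by rwa [proj_snoc])
    exact ⟨_, ⟨⟨_, hz⟩, X, hX, A, hA, B, hB, rfl⟩, proj_image_signSet (hord X hX) ⟨_, hz⟩ hA hB⟩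

end Stack

section GoodDecomposition

variable {D R : Type*} [DivisionRing D] [AddCommGroup R] [LinearOrder R] [Module D R]
  [TopologicalSpace R]

/-- A linear decomposition that is a stratification and whose stars are open cells. The dimension
of the members is recorded by a single function, so that it can be compared between members. -/
structure IsGoodDecomposition (D : Type*) {R : Type*} [DivisionRing D] [AddCommGroup R]
    [LinearOrder R] [Module D R] [TopologicalSpace R] {n : ℕ} (𝒞 : Set (Set (Fin n → R))) :
    Prop where
  linear : IsLinearDecomposition D 𝒞
  finite : 𝒞.Finite
  partition : Setoid.IsPartition 𝒞
  definable : ∀ A ∈ 𝒞, Set.univ.Definable (language D) A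
  exists_dim : ∃ dim : Set (Fin n → R) → ℕ, (∀ A ∈ 𝒞, IsCellOfDim D n (dim A) A) ∧
    ∀ A ∈ 𝒞, ∀ B ∈ 𝒞, (B ∩ closure A).Nonempty → B ≠ A → dim B < dim A
  subset_closure : ∀ A ∈ 𝒞, ∀ B ∈ 𝒞, (B ∩ closure A).Nonempty → B ⊆ closure A
  isCell_star : ∀ A ∈ 𝒞, IsCell D (star 𝒞 A)
  isOpen_star : ∀ A ∈ 𝒞, IsOpen (star 𝒞 A)

theorem IsGoodDecomposition.isStratification {n : ℕ} {𝒞 : Set (Set (Fin n → R))}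
    (h : IsGoodDecomposition D 𝒞) : IsStratification D 𝒞 := by
  obtain ⟨dim, hdim, hlt⟩ := h.exists_dim
  refine ⟨h.finite, h.partition, fun A hA => ⟨_, hdim A hA⟩, fun A hA =>
    ⟨{B | B ∈ 𝒞 ∧ B ≠ A ∧ B ⊆ closure A}, fun B hB => hB.1, ?_, fun B hB =>
      ⟨_, _, hdim B hB.1, hdim A hA, hlt A hA B hB.1 ?_ hB.2.1⟩⟩⟩
  · ext x
    constructor
    · rintro ⟨hx, hxA⟩
      obtain ⟨B, ⟨hB, hxB⟩, -⟩ := h.partition.2 x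
      exact ⟨B, ⟨hB, fun hBA => hxA (hBA ▸ hxB), h.subset_closure A hA B hB ⟨x, hxB, hx⟩⟩, hxB⟩
    · rintro ⟨B, ⟨hB, hBA, hBcl⟩, hxB⟩
      exact ⟨hBcl hxB, fun hxA => hBA (eq_of_mem_of_isPartition h.partition hB hA hxB hxA)⟩
  · obtain ⟨x, hx⟩ := Setoid.nonempty_of_mem_partition h.partition hB.1
    exact ⟨x, hx, hB.2.2 hx⟩

theorem IsGoodDecomposition.definable_star {n : ℕ} {𝒞 : Set (Set (Fin n → R))}
    (h : IsGoodDecomposition D 𝒞) (Y : Set (Fin n → R)) :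
    Set.univ.Definable (language D) (star 𝒞 Y) := by
  have hfin : {A | A ∈ 𝒞 ∧ (Y ∩ closure A).Nonempty}.Finite := h.finite.subset fun A hA => hA.1
  have := hfin.to_subtype
  rw [star, Set.sUnion_eq_iUnion]
  exact Set.definable_iUnion_of_finite fun A => h.definable A.1 A.2.1

theorem IsLinearDecomposition.finite {n : ℕ} {𝒟 : Set (Set (Fin n → R))}
    (h : IsLinearDecomposition D 𝒟) : 𝒟.Finite := by
  cases n with
  | zero =>
    have h : 𝒟 = {Set.univ} := h.1
    exact h ▸ Set.finite_singleton _
  | succ n => exact h.1.1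

theorem IsLinearDecomposition.partition {n : ℕ} {𝒟 : Set (Set (Fin n → R))}
    (h : IsLinearDecomposition D 𝒟) : Setoid.IsPartition 𝒟 := by
  cases n with
  | zero =>
    have h : 𝒟 = {Set.univ} := h.1
    subst h
    refine ⟨fun h => Set.empty_ne_univ (Set.mem_singleton_iff.1 h), fun a => ?_⟩
    exact ⟨Set.univ, ⟨rfl, trivial⟩, fun B hB => hB.1⟩
  | succ n => exact h.1.2.1

theorem IsLinearDecomposition.isCell {n : ℕ} {𝒟 : Set (Set (Fin n → R))}
    (h : IsLinearDecomposition D 𝒟) : ∀ A ∈ 𝒟, IsCell D A := by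
  cases n with
  | zero =>
    have h : 𝒟 = {Set.univ} := h.1
    subst h
    exact fun A hA => ⟨0, rfl, hA⟩
  | succ n => exact h.1.2.2.1

/-- The case of a one-point space, which arises for `n = 0` and for trivial `R`: the whole space is
the only member of a decomposition. -/
theorem isGoodDecomposition_of_subsingleton {n : ℕ} [Subsingleton (Fin n → R)]
    {𝒟 : Set (Set (Fin n → R))} (h : IsLinearDecomposition D 𝒟) : IsGoodDecomposition D 𝒟 := by
  classical
  have huniv : ∀ A ∈ 𝒟, A = Set.univ := fun A hA =>
    Subsingleton.eq_univ_of_nonempty (Setoid.nonempty_of_mem_partition h.partition hA)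
  have hstar : ∀ A ∈ 𝒟, star 𝒟 A = A := fun A hA => by
    rw [huniv A hA, Set.eq_univ_iff_forall]
    exact fun x => ⟨A, ⟨hA, x, trivial, subset_closure (huniv A hA ▸ trivial)⟩,
      huniv A hA ▸ trivial⟩
  choose! dim hdim using h.isCell
  refine ⟨h, h.finite, h.partition, fun A hA => huniv A hA ▸ Set.definable_univ,
    ⟨dim, hdim, fun A hA B hB _ hBA => absurd ((huniv B hB).trans (huniv A hA).symm) hBA⟩,
    fun A hA B _ _ => ?_, fun A hA => ?_, fun A hA => ?_⟩
  · rw [huniv A hA, closure_univ]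
    exact Set.subset_univ B
  · rw [hstar A hA]
    exact h.isCell A hA
  · rw [hstar A hA, huniv A hA]
    exact isOpen_univ

end GoodDecomposition

section GoodStack

variable {D R : Type*} [DivisionRing D] [LinearOrder D] [IsStrictOrderedRing D]
  [AddCommGroup R] [LinearOrder R] [IsOrderedAddMonoid R] [Module D R]
  [IsStrictOrderedModule D R] [TopologicalSpace R] [OrderTopology R]

variable {n : ℕ} {𝒞 : Set (Set (Fin n → R))} {L : Finset ((Fin n → R) → R)}

/-- The star of the sign set `(A, B)` over `Y` consists of all sign sets `(A', B')` with `A ⊆ A'`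
and `B ⊆ B'` over the star of `Y`, so all the bounds from outside `A` and `B` disappear. -/
theorem star_stack [Nontrivial R] [DenselyOrdered R] (hgood : IsGoodDecomposition D 𝒞)
    (hL : ∀ l ∈ L, LinearOn D Set.univ l) (hord : ∀ X ∈ 𝒞, SameOrderOn L X)
    {Y : Set (Fin n → R)} (hY : Y ∈ 𝒞) {A B : Finset ((Fin n → R) → R)} (hA : A ⊆ L) (hB : B ⊆ L)
    (hne : (signSet L Y A B).Nonempty) :
    star (stack 𝒞 L) (signSet L Y A B) = band (star 𝒞 Y) A B := by
  ext z
  constructor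
  · rintro ⟨_, ⟨⟨-, X, hX, A', hA', B', hB', rfl⟩, hcl⟩, hz⟩
    obtain ⟨hYX, hAA, hBB⟩ := of_signSet_inter_closure_nonempty hL hA hB hcl
    exact ⟨⟨X, ⟨hX, hYX⟩, hz.1⟩, fun a ha => (hz.2 a (hA ha)).1.2 (hAA ha),
      fun b hb => (hz.2 b (hB hb)).2.2 (hBB hb)⟩
  · rintro ⟨⟨X, ⟨hX, hYX⟩, hzX⟩, hzA, hzB⟩
    obtain ⟨A', hA', B', hB', hz⟩ := exists_mem_signSet (L := L) hzX
    refine ⟨_, ⟨⟨⟨z, hz⟩, X, hX, A', hA', B', hB', rfl⟩, ?_⟩, hz⟩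
    obtain ⟨w, hw⟩ := hne
    exact ⟨w, hw, signSet_subset_closure hL (hord X hX) ⟨z, hz⟩ hA' hB'
      (hgood.subset_closure X hX Y hY hYX) (fun a ha => (hz.2 a (hA ha)).1.1 (hzA a ha))
      (fun b hb => (hz.2 b (hB hb)).2.1 (hzB b hb)) hw⟩

/-- The bounding functions of a sign set over `Y` are separated on the whole star of `Y`. -/
theorem lt_on_star (hL : ∀ l ∈ L, LinearOn D Set.univ l) (hord : ∀ X ∈ 𝒞, SameOrderOn L X)
    {Y : Set (Fin n → R)} (hY : Y ∈ 𝒞) {A B : Finset ((Fin n → R) → R)} (hA : A ⊆ L) (hB : B ⊆ L)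
    (hne : (signSet L Y A B).Nonempty) : ∀ a ∈ A, ∀ b ∈ B, ∀ x ∈ star 𝒞 Y, a x < b x := by
  rintro a ha b hb x ⟨X, ⟨hX, hYX⟩, hx⟩
  exact (hord X hX).lt_of_inter_closure_nonempty hL hYX (hA ha) (hB hb)
    (lt_of_signSet_nonempty (hord Y hY) hne hA hB a ha b hb) x hx

/-- The dimension of a sign set over `X` is that of `X` if it is a graph, and one more if it is a
band. It drops on the frontier: over a smaller cell the base loses at least one dimension, and over
`X` itself only a band has frontier members, which are graphs. -/
theorem exists_dim_stack [Nontrivial R] [DenselyOrdered R] (hgood : IsGoodDecomposition D 𝒞)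
    (hL : ∀ l ∈ L, LinearOn D Set.univ l) (hord : ∀ X ∈ 𝒞, SameOrderOn L X) :
    ∃ dim : Set (Fin (n + 1) → R) → ℕ,
      (∀ S ∈ stack 𝒞 L, IsCellOfDim D (n + 1) (dim S) S) ∧
      ∀ S ∈ stack 𝒞 L, ∀ T ∈ stack 𝒞 L, (T ∩ closure S).Nonempty → T ≠ S → dim T < dim S := by
  classical
  obtain ⟨dim, hdim, hlt⟩ := hgood.exists_dim
  let dim' : Set (Fin (n + 1) → R) → ℕ := fun S =>
    if ∃ l ∈ L, S = graph (proj '' S) l then dim (proj '' S) else dim (proj '' S) + 1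
  have hgraph : ∀ X ∈ 𝒞, ∀ A ⊆ L, ∀ B ⊆ L, (signSet L X A B).Nonempty →
      ((∃ l ∈ L, signSet L X A B = graph X l) ↔ ∃ l ∈ L, l ∉ A ∧ l ∉ B) := by
    intro X hX A hA B hB hne
    constructor
    · rintro ⟨l, hl, h⟩
      obtain ⟨z, hz⟩ := hne
      have hz' := h ▸ hz
      exact ⟨l, hl, fun hlA => ((hz.2 l hl).1.2 hlA).ne' hz'.2,
        fun hlB => ((hz.2 l hl).2.2 hlB).ne hz'.2⟩
    · rintro ⟨l, hl, hlA, hlB⟩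
      exact ⟨l, hl, signSet_eq_graph (hord X hX) hne hl hlA hlB⟩
  have hdim' : ∀ X ∈ 𝒞, ∀ A ⊆ L, ∀ B ⊆ L, (signSet L X A B).Nonempty →
      dim' (signSet L X A B) = if ∃ l ∈ L, l ∉ A ∧ l ∉ B then dim X else dim X + 1 := by
    intro X hX A hA B hB hne
    simp only [dim', proj_image_signSet (hord X hX) hne hA hB, hgraph X hX A hA B hB hne]
  refine ⟨dim', ?_, ?_⟩
  · rintro _ ⟨hne, X, hX, A, hA, B, hB, rfl⟩
    rw [hdim' X hX A hA B hB hne]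
    split_ifs with h
    · obtain ⟨l, hl, hlA, hlB⟩ := h
      rw [signSet_eq_graph (hord X hX) hne hl hlA hlB]
      exact isCellOfDim_graph (hdim X hX) (hgood.definable X hX) (hL l hl)
    · push Not at h
      rw [signSet_eq_band hA hB fun l hl => or_iff_not_imp_left.2 (h l hl)]
      exact isCellOfDim_band (hdim X hX) (hgood.definable X hX) (fun a ha => hL a (hA ha))
        (fun b hb => hL b (hB hb)) (lt_of_signSet_nonempty (hord X hX) hne hA hB)
  · rintro _ ⟨hne, X, hX, A, hA, B, hB, rfl⟩ _ ⟨hne', Y, hY, A', hA', B', hB', rfl⟩ hcl hTS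
    obtain ⟨hYX, hAA, hBB⟩ := of_signSet_inter_closure_nonempty hL hA' hB' hcl
    rw [hdim' X hX A hA B hB hne, hdim' Y hY A' hA' B' hB' hne']
    have hmono : (∃ l ∈ L, l ∉ A ∧ l ∉ B) → ∃ l ∈ L, l ∉ A' ∧ l ∉ B' :=
      fun ⟨l, hl, hlA, hlB⟩ => ⟨l, hl, fun h => hlA (hAA h), fun h => hlB (hBB h)⟩
    by_cases hXY : Y = X
    · subst hXY
      have hS : ¬ ∃ l ∈ L, l ∉ A ∧ l ∉ B := by
        rintro ⟨l, hl, hlA, hlB⟩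
        refine hTS ?_
        rw [signSet_eq_graph (hord Y hY) hne hl hlA hlB,
          signSet_eq_graph (hord Y hY) hne' hl (fun h => hlA (hAA h)) fun h => hlB (hBB h)]
      have hT : ∃ l ∈ L, l ∉ A' ∧ l ∉ B' := by
        by_contra h
        push Not at h
        obtain ⟨z, hz⟩ := hne
        have hAeq : A' = A := hAA.antisymm fun l hl => by
          by_contra hlA'
          exact lt_asymm ((hz.2 l (hA hl)).1.2 hl)
            ((hz.2 l (hA hl)).2.2 (hBB (h l (hA hl) hlA')))
        have hBeq : B' = B := hBB.antisymm fun l hl => by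
          by_contra hlB'
          exact lt_asymm ((hz.2 l (hB hl)).2.2 hl)
            ((hz.2 l (hB hl)).1.2 (hAA (by_contra fun h' => hlB' (h l (hB hl) h'))))
        exact hTS (by rw [hAeq, hBeq])
      rw [if_neg hS, if_pos hT]
      exact Nat.lt_succ_self _
    · have := hlt X hX Y hY hYX hXY
      split_ifs with h1 h2 h2
      · exact this
      · omega
      · exact absurd (hmono h2) h1
      · omega

theorem IsGoodDecomposition.stack [Nontrivial R] (hgood : IsGoodDecomposition D 𝒞)
    (hL : ∀ l ∈ L, LinearOn D Set.univ l) (hord : ∀ X ∈ 𝒞, SameOrderOn L X) :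
    IsGoodDecomposition D (stack 𝒞 L) := by
  have := denselyOrdered D (R := R)
  have hdim := exists_dim_stack hgood hL hord
  have hpart := stack_isPartition (L := L) hgood.partition
  refine ⟨⟨⟨stack_finite hgood.finite, hpart, ?_, ?_⟩, ?_⟩, stack_finite hgood.finite, hpart,
    ?_, hdim, ?_, ?_, ?_⟩
  · obtain ⟨dim, h, -⟩ := hdim
    exact fun S hS => ⟨_, h S hS⟩
  · rw [proj_image_stack hgood.partition hord]
    exact hgood.linear.1
  · rintro _ ⟨hne, X, hX, A, hA, B, hB, rfl⟩
    by_cases h : ∀ l ∈ L, l ∈ A ∨ l ∈ B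
    · rw [signSet_eq_band hA hB h]
      exact isLinearCell_band (hgood.linear.2 X hX) hL (hord X hX)
        (Setoid.nonempty_of_mem_partition hgood.partition hX) hA hB
        (lt_of_signSet_nonempty (hord X hX) hne hA hB)
    · push Not at h
      obtain ⟨l, hl, hlA, hlB⟩ := h
      rw [signSet_eq_graph (hord X hX) hne hl hlA hlB]
      exact Or.inl ⟨X, l, hgood.linear.2 X hX, (hL l hl).mono (Set.subset_univ X), rfl⟩
  · rintro _ ⟨hne, X, hX, A, hA, B, hB, rfl⟩
    by_cases h : ∀ l ∈ L, l ∈ A ∨ l ∈ B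
    · rw [signSet_eq_band hA hB h]
      exact definable_band (hgood.definable X hX) (fun a ha => hL a (hA ha))
        fun b hb => hL b (hB hb)
    · push Not at h
      obtain ⟨l, hl, hlA, hlB⟩ := h
      rw [signSet_eq_graph (hord X hX) hne hl hlA hlB]
      exact definable_graph_linearOn (hgood.definable X hX) (hL l hl)
  · rintro _ ⟨hne, X, hX, A, hA, B, hB, rfl⟩ _ ⟨hne', Y, hY, A', hA', B', hB', rfl⟩ hcl
    obtain ⟨hYX, hAA, hBB⟩ := of_signSet_inter_closure_nonempty hL hA' hB' hcl
    exact signSet_subset_closure hL (hord X hX) hne hA hB (hgood.subset_closure X hX Y hY hYX)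
      hAA hBB
  · rintro _ ⟨hne, Y, hY, A, hA, B, hB, rfl⟩
    rw [star_stack hgood hL hord hY hA hB hne]
    obtain ⟨d, hd⟩ := hgood.isCell_star Y hY
    exact ⟨d + 1, isCellOfDim_band hd (hgood.definable_star Y) (fun a ha => hL a (hA ha))
      (fun b hb => hL b (hB hb)) (lt_on_star hL hord hY hA hB hne)⟩
  · rintro _ ⟨hne, Y, hY, A, hA, B, hB, rfl⟩
    rw [star_stack hgood hL hord hY hA hB hne]
    exact isOpen_band (hgood.isOpen_star Y hY) (fun a ha => hL a (hA ha)) fun b hb => hL b (hB hb)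

end GoodStack

/-! ### Decompositions adapted to finitely many affine functions -/

section LinearCells

variable {D R : Type*} [DivisionRing D] [AddCommGroup R] [LinearOrder R] [IsOrderedAddMonoid R]
  [Module D R]

/-- Membership in a linear cell depends only on which of finitely many affine functions are
positive. -/
theorem IsLinearCell.exists_finset {n : ℕ} {s : Set (Fin n → R)} (hs : IsLinearCell D n s) :
    ∃ F : Finset ((Fin n → R) → R), (∀ f ∈ F, LinearOn D Set.univ f) ∧
      ∀ x y, (∀ f ∈ F, 0 < f x ↔ 0 < f y) → x ∈ s → y ∈ s := by
  classical
  induction n with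
  | zero =>
    have hs : s = Set.univ := hs
    exact ⟨∅, by simp, fun x y _ _ => hs ▸ trivial⟩
  | succ n ih =>
    -- One bound of a cylinder is controlled by its difference with the last coordinate.
    have hbound : ∀ (X : Set (Fin n → R)) (f : (Fin n → R) → Ext R),
        WithInfty (LinearOn D X) X f → ∃ F : Finset ((Fin (n + 1) → R) → R),
          (∀ g ∈ F, LinearOn D Set.univ g) ∧ ∀ z w : Fin (n + 1) → R, proj z ∈ X → proj w ∈ X →
            (∀ g ∈ F, 0 < g z ↔ 0 < g w) →
            (f (proj z) < Ext.of (z (Fin.last n)) → f (proj w) < Ext.of (w (Fin.last n))) ∧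
            (Ext.of (z (Fin.last n)) < f (proj z) → Ext.of (w (Fin.last n)) < f (proj w)) := by
      rintro X f (⟨f₀, hf₀, hf⟩ | hf | hf)
      · obtain ⟨l, hl, hfl⟩ := hf₀.exists_extension
        refine ⟨{(fun z => z (Fin.last n)) - fun z => l (proj z),
          (fun z => l (proj z)) - fun z => z (Fin.last n)}, ?_, fun z w hz hw h => ?_⟩
        · intro g hg
          rcases Finset.mem_insert.1 hg with rfl | hg
          · exact linearOn_last.sub hl.comp_proj
          · rw [Finset.mem_singleton.1 hg]
            exact hl.comp_proj.sub linearOn_last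
        · simp only [Finset.mem_insert, Finset.mem_singleton, forall_eq_or_imp, forall_eq,
            Pi.sub_apply, sub_pos] at h
          rw [hf _ hz, hf _ hw, hfl _ hz, hfl _ hw]
          simp only [Ext.of_lt_of]
          exact ⟨h.1.1, h.2.1⟩
      · refine ⟨∅, by simp, fun z w hz hw _ => ?_⟩
        rw [hf _ hz, hf _ hw]
        exact ⟨fun _ => Ext.bot_lt_of _, fun h => absurd h not_lt_bot⟩
      · refine ⟨∅, by simp, fun z w hz hw _ => ?_⟩
        rw [hf _ hz, hf _ hw]
        exact ⟨fun h => absurd h not_top_lt, fun _ => Ext.of_lt_top _⟩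
    have hbase : ∀ X : Set (Fin n → R), IsLinearCell D n X →
        ∃ F : Finset ((Fin (n + 1) → R) → R), (∀ f ∈ F, LinearOn D Set.univ f) ∧
          ∀ z w, (∀ f ∈ F, 0 < f z ↔ 0 < f w) → proj z ∈ X → proj w ∈ X := by
      intro X hX
      obtain ⟨F, hF, hFX⟩ := ih hX
      refine ⟨F.image fun f z => f (proj z), fun g hg => ?_, fun z w h => hFX _ _ fun f hf => ?_⟩
      · obtain ⟨f, hf, rfl⟩ := Finset.mem_image.1 hg
        exact (hF f hf).comp_proj
      · exact h _ (Finset.mem_image_of_mem (fun f (z : Fin (n + 1) → R) => f (proj z)) hf)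
    rcases hs with ⟨X, f, hX, hf, rfl⟩ | ⟨X, f, g, hX, hf, hg, -, rfl⟩
    · obtain ⟨F, hF, hFX⟩ := hbase X hX
      obtain ⟨G, hG, hGX⟩ := hbound X (fun x => Ext.of (f x)) (Or.inl ⟨f, hf, fun _ _ => rfl⟩)
      refine ⟨F ∪ G, fun f hf => (Finset.mem_union.1 hf).elim (hF f) (hG f), fun z w h hz => ?_⟩
      have hw := hFX z w (fun f hf => h f (Finset.mem_union_left G hf)) hz.1
      have h' := hGX w z hw hz.1 fun f hf => (h f (Finset.mem_union_right F hf)).symm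
      simp only [Ext.of_lt_of] at h'
      exact ⟨hw, le_antisymm (not_lt.1 fun hlt => (h'.1 hlt).ne' hz.2)
        (not_lt.1 fun hlt => (h'.2 hlt).ne hz.2)⟩
    · obtain ⟨F, hF, hFX⟩ := hbase X hX
      obtain ⟨G, hG, hGX⟩ := hbound X f hf
      obtain ⟨H, hH, hHX⟩ := hbound X g hg
      refine ⟨F ∪ (G ∪ H), fun f hf => (Finset.mem_union.1 hf).elim (hF f) fun hf =>
        (Finset.mem_union.1 hf).elim (hG f) (hH f), fun z w h hz => ?_⟩
      have hw := hFX z w (fun f hf => h f (Finset.mem_union_left _ hf)) hz.1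
      exact ⟨hw, (hGX z w hz.1 hw fun f hf => h f (Finset.mem_union_right _
          (Finset.mem_union_left _ hf))).1 hz.2.1,
        (hHX z w hz.1 hw fun f hf => h f (Finset.mem_union_right _
          (Finset.mem_union_right _ hf))).2 hz.2.2⟩

end LinearCells

section Adapted

variable {D R : Type*} [DivisionRing D] [LinearOrder D] [IsStrictOrderedRing D]
  [AddCommGroup R] [LinearOrder R] [IsOrderedAddMonoid R] [Module D R]
  [IsStrictOrderedModule D R]

/-- If `L` contains the function whose graph is the zero set of `z ↦ g (proj z) + c • z_last`
(for `c = 0`, where `c⁻¹ = 0`, the sign is already decided by `g` on `X`), this affine function is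
positive on all of a sign set as soon as it is positive at one point of it. -/
theorem signSet_pos_imp_pos {n : ℕ} {L : Finset ((Fin n → R) → R)}
    {X : Set (Fin n → R)} {A B : Finset ((Fin n → R) → R)}
    {g l : (Fin n → R) → R} {c : D} (hl : l ∈ L) (hgl : ∀ x, l x = -(c⁻¹ • g x))
    (hg : ∀ x ∈ X, ∀ y ∈ X, 0 < g x → 0 < g y) {z w : Fin (n + 1) → R}
    (hz : z ∈ signSet L X A B) (hw : w ∈ signSet L X A B)
    (h : 0 < g (proj z) + c • z (Fin.last n)) : 0 < g (proj w) + c • w (Fin.last n) := by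
  rcases eq_or_ne c 0 with rfl | hc
  · simp only [zero_smul, add_zero] at h ⊢
    exact hg _ hz.1 _ hw.1 h
  · have key : ∀ v : Fin (n + 1) → R,
        g (proj v) + c • v (Fin.last n) = c • (v (Fin.last n) - l (proj v)) := by
      intro v
      rw [hgl, sub_neg_eq_add, smul_add, smul_smul, mul_inv_cancel₀ hc, one_smul, add_comm]
    rw [key] at h ⊢
    rcases hc.lt_or_gt with hc | hc
    · have hneg : ∀ r : R, 0 < c • r ↔ r < 0 := fun r => by
        rw [← neg_smul_neg, smul_pos_iff_of_pos_left (neg_pos.2 hc), neg_pos]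
      rw [hneg, sub_neg] at h ⊢
      exact (hw.2 l hl).2.2 ((hz.2 l hl).2.1 h)
    · rw [smul_pos_iff_of_pos_left hc, sub_pos] at h ⊢
      exact (hw.2 l hl).1.2 ((hz.2 l hl).1.1 h)

variable [TopologicalSpace R] [OrderTopology R]

/-- By induction on `n`: the functions of `F` that involve the last coordinate are solved for it,
which gives a family `L`; the decomposition one dimension lower is chosen so that the differences of
members of `L` and the remaining functions of `F` have constant sign on its members. -/
theorem exists_isGoodDecomposition [Nontrivial R] (n : ℕ) (F : Finset ((Fin n → R) → R))
    (hF : ∀ f ∈ F, LinearOn D Set.univ f) :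
    ∃ 𝒞 : Set (Set (Fin n → R)), IsGoodDecomposition D 𝒞 ∧
      ∀ f ∈ F, ∀ X ∈ 𝒞, ∀ x ∈ X, ∀ y ∈ X, 0 < f x → 0 < f y := by
  classical
  induction n with
  | zero =>
    refine ⟨{Set.univ}, isGoodDecomposition_of_subsingleton ⟨rfl, ?_⟩, fun f _ X _ x _ y _ h => ?_⟩
    · rintro A rfl
      rfl
    · rwa [Subsingleton.elim y x]
  | succ n ih =>
    choose! g c hg hgc using fun f hf => (hF f hf).exists_eq_proj_add_smul_last
    let L : Finset ((Fin n → R) → R) := F.image fun f => -((c f)⁻¹ • g f)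
    have hL : ∀ l ∈ L, LinearOn D Set.univ l := by
      intro l hl
      obtain ⟨f, hf, rfl⟩ := Finset.mem_image.1 hl
      exact ((hg f hf).smul _).neg
    obtain ⟨𝒞, hgood, hpos⟩ := ih (F.image g ∪ (L ×ˢ L).image fun p => p.2 - p.1) (by
      intro f hf
      rcases Finset.mem_union.1 hf with hf | hf
      · obtain ⟨f', hf', rfl⟩ := Finset.mem_image.1 hf
        exact hg f' hf'
      · obtain ⟨p, hp, rfl⟩ := Finset.mem_image.1 hf
        exact (hL _ (Finset.mem_product.1 hp).2).sub (hL _ (Finset.mem_product.1 hp).1))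
    have hord : ∀ X ∈ 𝒞, SameOrderOn L X := by
      intro X hX l hl l' hl' x hx y hy h
      have := hpos (l' - l) (Finset.mem_union_right _ (Finset.mem_image.2
        ⟨(l, l'), Finset.mem_product.2 ⟨hl, hl'⟩, rfl⟩)) X hX x hx y hy (sub_pos.2 h)
      exact sub_pos.1 this
    refine ⟨stack 𝒞 L, hgood.stack hL hord, ?_⟩
    rintro f hf _ ⟨-, X, hX, A, hA, B, hB, rfl⟩ z hz w hw h
    rw [hgc f hf] at h ⊢
    exact signSet_pos_imp_pos (Finset.mem_image_of_mem _ hf) (fun x => rfl)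
      (hpos (g f) (Finset.mem_union_left _ (Finset.mem_image_of_mem _ hf)) X hX) hz hw h

theorem exists_isGoodDecomposition_refines [Nontrivial R] {n : ℕ} {𝒟 : Set (Set (Fin n → R))}
    (h : IsLinearDecomposition D 𝒟) :
    ∃ 𝒞 : Set (Set (Fin n → R)), IsGoodDecomposition D 𝒞 ∧ Refines 𝒞 𝒟 := by
  classical
  choose! F hF hFB using fun B hB => (h.2 B hB).exists_finset
  obtain ⟨𝒞, hgood, hpos⟩ := exists_isGoodDecomposition (D := D) n
    (h.finite.toFinset.biUnion F) (by
      intro f hf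
      obtain ⟨B, hB, hfB⟩ := Finset.mem_biUnion.1 hf
      exact hF B (h.finite.mem_toFinset.1 hB) f hfB)
  refine ⟨𝒞, hgood, fun B hB => ⟨{A | A ∈ 𝒞 ∧ A ⊆ B}, fun A hA => hA.1, ?_⟩⟩
  refine Set.Subset.antisymm (fun x hx => ?_) (Set.sUnion_subset fun A hA => hA.2)
  obtain ⟨A, ⟨hA, hxA⟩, -⟩ := hgood.partition.2 x
  refine ⟨A, ⟨hA, fun y hyA => hFB B hB x y (fun f hf => ?_) hx⟩, hxA⟩
  have hf' := Finset.mem_biUnion.2 ⟨B, h.finite.mem_toFinset.2 hB, hf⟩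
  exact ⟨hpos f hf' A hA x hxA y hyA, hpos f hf' A hA y hyA x hxA⟩

end Adapted

end OVS


theorem theorem1p2 {D R : Type*} [DivisionRing D] [LinearOrder D] [IsStrictOrderedRing D]
    [AddCommGroup R] [LinearOrder R] [IsOrderedAddMonoid R] [Module D R]
    [IsStrictOrderedModule D R] [TopologicalSpace R] [OrderTopology R]
    (n : ℕ) (𝒟 : Set (Set (Fin n → R))) (h𝒟 : OVS.IsLinearDecomposition D 𝒟) :
    ∃ 𝒞 : Set (Set (Fin n → R)),
      OVS.IsLinearDecomposition D 𝒞 ∧ OVS.Refines 𝒞 𝒟 ∧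
      (∀ C ∈ 𝒞, OVS.IsCell D (OVS.star 𝒞 C) ∧ IsOpen (OVS.star 𝒞 C)) ∧
      OVS.IsStratification D 𝒞 := by
  obtain ⟨𝒞, hgood, href⟩ : ∃ 𝒞, OVS.IsGoodDecomposition D 𝒞 ∧ OVS.Refines 𝒞 𝒟 := by
    rcases subsingleton_or_nontrivial R with hR | hR
    · exact ⟨𝒟, OVS.isGoodDecomposition_of_subsingleton h𝒟, fun B hB =>
        ⟨{B}, Set.singleton_subset_iff.2 hB, (Set.sUnion_singleton B).symm⟩⟩
    · exact OVS.exists_isGoodDecomposition_refines h𝒟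
  exact ⟨𝒞, hgood.linear, href, fun C hC => ⟨hgood.isCell_star C hC, hgood.isOpen_star C hC⟩,
    hgood.isStratification⟩
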